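/- Let $W$ be an even Coxeter group of finite rank, that is, $W = \langle s_1,\dots,s_n \mid (s_is_j)^{m_{ij}} = 1 \text{ whenever } m_{ij}\neq\infty\rangle$, where $(m_{ij})$ is a symmetric $n\times n$ matrix with $m_{ii}=1$ for all $i$ and with each $m_{ij}$, $i\ne j$, either a positive even integer or $\infty$. Then every element $x\in W$ of finite order is conjugacy distinguished in $W$: its conjugacy class $x^W=\{w^{-1}xw \mid w\in W\}$ is closed in the profinite topology on $W$, i.e. the topology whose basic open sets are the cosets of the normal subgroups of finite index in $W$. -/

import Mathlib

open scoped Pointwise Topology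

/-- A Coxeter matrix is even if all its off-diagonal entries are even or infinite
(Mathlib encodes `∞` as `0`, which is even). -/
def CoxeterMatrix.IsEven {B : Type*} (M : CoxeterMatrix B) : Prop :=
  ∀ i j : B, i ≠ j → Even (M i j)

/-- The profinite topology on a group: the topology whose basic open sets are the cosets of
normal subgroups of finite index. -/
abbrev profiniteTopology (G : Type*) [Group G] : TopologicalSpace G :=
  TopologicalSpace.generateFrom
    {U : Set G | ∃ (N : Subgroup G) (g : G), N.Normal ∧ N.FiniteIndex ∧ U = g • (N : Set G)}

/-- A subset of a group is separable if it is closed in the profinite topology. -/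
def IsSeparableSubset {G : Type*} [Group G] (S : Set G) : Prop :=
  IsClosed[profiniteTopology G] S

/-- An element is conjugacy distinguished if its conjugacy class is separable. -/
def IsConjugacyDistinguished {G : Type*} [Group G] (x : G) : Prop :=
  IsSeparableSubset (conjugatesOf x)

/-!
An element `x` of finite order fixes a linear functional on the geometric representation that is
positive on all but finitely many positive roots, namely the sum of the translates of the coordinate
sum by the powers of `x`. Simple reflections move such a functional into the closed fundamental
chamber, where its stabilizer is a finite standard parabolic subgroup; so `x` is conjugate into a
finite standard parabolic subgroup.

Evenness provides commuting retractions of the group onto all its standard parabolic subgroups.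
Hence elements conjugate into finite `W_I` and `W_J` are conjugate as soon as their images in `W_I`
and in `W_J` are. If instead `y` has infinite order, a finite quotient in which `y ^ orderOf x`
survives separates `y` from the conjugates of `x`. Such a quotient exists because every element
lies in some `W_K` with `K` finite, and `W_K` acts faithfully on a lattice: the entries
`-2 cos (π / m)` of the Cartan form are algebraic integers.
-/

section Separation

variable {G : Type*} [Group G] {x y : G}

/-- Two elements of a group are conjugacy separated if their images in some finite quotient are
not conjugate. -/
def ConjugacySeparated (x y : G) : Prop :=
  ∃ N : FiniteIndexNormalSubgroup G,
    ¬ IsConj (x : G ⧸ N.toSubgroup) (y : G ⧸ N.toSubgroup)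

theorem ConjugacySeparated.of_not_isConj_map {H : Type*} [Group H] [Finite H] (f : G →* H)
    (h : ¬ IsConj (f x) (f y)) : ConjugacySeparated x y := by
  refine ⟨.ofSubgroup f.ker, fun hconj ↦ h ?_⟩
  simpa using (QuotientGroup.kerLift f).map_isConj hconj

theorem ConjugacySeparated.of_isOfFinOrder_of_not [Group.ResiduallyFinite G] (hx : IsOfFinOrder x)
    (hy : ¬ IsOfFinOrder y) : ConjugacySeparated x y := by
  have hpow : y ^ orderOf x ≠ 1 := fun h ↦
    hy (isOfFinOrder_iff_pow_eq_one.mpr ⟨_, hx.orderOf_pos, h⟩)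
  obtain ⟨N, hN⟩ := Group.exists_finiteIndexNormalSubgroup_notMem _ hpow
  refine ⟨N, fun hconj ↦ hN ?_⟩
  have hquot := hconj.pow (orderOf x)
  rw [← QuotientGroup.mk_pow, ← QuotientGroup.mk_pow, pow_orderOf_eq_one, QuotientGroup.mk_one,
    isConj_one_right] at hquot
  exact (QuotientGroup.eq_one_iff _).mp hquot

theorem isConjugacyDistinguished_of_forall_conjugacySeparated
    (h : ∀ y, ¬ IsConj x y → ConjugacySeparated x y) : IsConjugacyDistinguished x := by
  let := profiniteTopology G
  refine ⟨isOpen_iff_forall_mem_open.mpr fun y hy ↦ ?_⟩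
  obtain ⟨N, hN⟩ := h y hy
  refine ⟨y • (N.toSubgroup : Set G), fun z hz hxz ↦ hN ?_,
    TopologicalSpace.isOpen_generateFrom_of_mem
      ⟨N.toSubgroup, y, inferInstance, inferInstance, rfl⟩,
    mem_own_leftCoset N.toSubgroup.toSubmonoid y⟩
  have hyz : (y : G ⧸ N.toSubgroup) = z := QuotientGroup.eq.mpr ((mem_leftCoset_iff y).mp hz)
  rw [hyz]
  exact (QuotientGroup.mk' N.toSubgroup).map_isConj hxz

/-- Reduction modulo an integer not dividing some nonzero matrix entry of `ρ g - 1`. -/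
theorem residuallyFinite_of_injective_representation {Λ : Type*} [AddCommGroup Λ]
    [Module.Finite ℤ Λ] [Module.Free ℤ Λ] (ρ : Representation ℤ G Λ)
    (hρ : Function.Injective ρ) : Group.ResiduallyFinite G := by
  classical
  let toMatrix := LinearMap.toMatrixAlgEquiv (Module.Free.chooseBasis ℤ Λ)
  refine Group.residuallyFinite_of_forall_exists_finite_monoidHom fun g hg ↦ ?_
  obtain ⟨i, j, hij⟩ : ∃ i j, toMatrix (ρ g) i j ≠ (1 : Matrix _ _ ℤ) i j := by
    by_contra! h
    exact hg (hρ (toMatrix.injective (by rw [Matrix.ext h, map_one, map_one])))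
  let n := (toMatrix (ρ g) i j - (1 : Matrix _ _ ℤ) i j).natAbs + 1
  let reduction := ((Int.castRingHom (ZMod n)).mapMatrix.toMonoidHom.comp
    (toMatrix.toAlgHom.toRingHom.toMonoidHom.comp ρ)).toHomUnits
  refine ⟨_, inferInstance, inferInstance, reduction, fun hone ↦ hij ?_⟩
  have hmod : (Int.castRingHom (ZMod n)).mapMatrix (toMatrix (ρ g)) =
      (Int.castRingHom (ZMod n)).mapMatrix 1 := by
    rw [map_one]
    exact congrArg Units.val hone
  have hdvd : (n : ℤ) ∣ toMatrix (ρ g) i j - (1 : Matrix _ _ ℤ) i j := by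
    rw [← ZMod.intCast_zmod_eq_zero_iff_dvd, Int.cast_sub, sub_eq_zero]
    exact congrFun (congrFun hmod i) j
  exact sub_eq_zero.mp (Int.eq_zero_of_dvd_of_natAbs_lt_natAbs hdvd (by omega))

end Separation

section Chebyshev

open Real Polynomial.Chebyshev

theorem chebyshevS_eval_two_mul_cos {θ : ℝ} (hθ : sin θ ≠ 0) (k : ℤ) :
    (S ℝ k).eval (2 * cos θ) = sin ((k + 1) * θ) / sin θ :=
  eq_div_of_mul_eq hθ (S_two_mul_real_cos θ k)

theorem sin_pi_div_pos {r : ℝ} (hr : 1 < r) : 0 < sin (π / r) :=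
  sin_pos_of_pos_of_lt_pi (by positivity) (div_lt_self pi_pos hr)

theorem chebyshevS_eval_two_mul_cos_pi_div_nonneg {m p : ℕ} (hm : m ≠ 1)
    (hp : m ≠ 0 → p ≤ m) : 0 ≤ (S ℝ (p - 1)).eval (2 * cos (π / m)) := by
  rcases eq_or_ne m 0 with rfl | hm0
  · simp [S_eval_two]
  have hm1 : (1 : ℝ) < m := by exact_mod_cast (by omega : 1 < m)
  have hpm : (p : ℝ) ≤ m := by exact_mod_cast hp hm0
  have hsin := sin_pi_div_pos hm1
  rw [chebyshevS_eval_two_mul_cos hsin.ne']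
  refine div_nonneg (sin_nonneg_of_nonneg_of_le_pi ?_ ?_) hsin.le
  · push_cast
    rw [sub_add_cancel]
    positivity
  · push_cast
    rw [sub_add_cancel, mul_div_left_comm]
    exact mul_le_of_le_one_right pi_pos.le (div_le_one_of_le₀ hpm (by positivity))

theorem sin_two_pi_div_ne_zero {m : ℕ} (hm : 3 ≤ m) : sin (2 * π / m) ≠ 0 := by
  have hm' : (1 : ℝ) < m / 2 := by
    have : (3 : ℝ) ≤ m := by exact_mod_cast hm
    linarith
  rw [mul_comm 2 π, ← div_div_eq_mul_div]
  exact (sin_pi_div_pos hm').ne'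

theorem chebyshevS_eval_two_mul_cos_two_pi_div_of_even {k : ℕ} (hk : 2 ≤ k) :
    (S ℝ (k - 1)).eval (2 * cos (2 * π / (2 * k : ℕ))) = 0 := by
  rw [chebyshevS_eval_two_mul_cos (sin_two_pi_div_ne_zero (by omega)), div_eq_zero_iff]
  left
  have hk0 : (k : ℝ) ≠ 0 := by positivity
  convert sin_pi using 2
  push_cast
  field_simp
  ring

theorem chebyshevS_eval_add_two_mul_cos_two_pi_div_of_odd {k : ℕ} (hk : 1 ≤ k) :
    (S ℝ k).eval (2 * cos (2 * π / (2 * k + 1 : ℕ))) +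
      (S ℝ (k - 1)).eval (2 * cos (2 * π / (2 * k + 1 : ℕ))) = 0 := by
  have hsin := sin_two_pi_div_ne_zero (m := 2 * k + 1) (by omega)
  rw [chebyshevS_eval_two_mul_cos hsin, chebyshevS_eval_two_mul_cos hsin, ← add_div,
    div_eq_zero_iff]
  left
  have hangle : ((k : ℤ) + 1 : ℝ) * (2 * π / (2 * k + 1 : ℕ)) =
      2 * π - ((k - 1 : ℤ) + 1) * (2 * π / (2 * k + 1 : ℕ)) := by
    push_cast
    field_simp
    ring
  rw [hangle, sin_two_pi_sub, neg_add_cancel]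

end Chebyshev

section Reflection

open Real Polynomial.Chebyshev Module

variable {V : Type*} [AddCommGroup V] [Module ℝ V] {x y : V} {f g : Dual ℝ V}

theorem reflection_mul_reflection_sq_eq_one (hf : f x = 2) (hg : g y = 2) (hfy : f y = 0)
    (hgx : g x = 0) : (reflection hf * reflection hg) ^ 2 = 1 := by
  ext v
  simp only [pow_two, LinearEquiv.mul_apply, reflection_apply, map_sub, map_smul, hf, hg, hfy,
    hgx, LinearEquiv.coe_one, id_eq]
  module

theorem reflection_mul_reflection_pow_eq_one (hf : f x = 2) (hg : g y = 2) {m : ℕ} (hm : 3 ≤ m)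
    (h : f y * g x = 4 * cos (π / m) ^ 2) : (reflection hf * reflection hg) ^ m = 1 := by
  ext v
  have ht : 2 * cos (2 * π / m) = f y * g x - 2 := by
    rw [h, mul_div_assoc, cos_two_mul]
    ring
  rw [reflection_mul_reflection_pow_apply hf hg m v _ ht]
  obtain ⟨k, rfl | rfl⟩ := m.even_or_odd'
  · rw [show ((2 * k : ℕ) - 2 : ℤ) / 2 = k - 1 by omega,
      show ((2 * k : ℕ) - 1 : ℤ) / 2 = k - 1 by omega,
      chebyshevS_eval_two_mul_cos_two_pi_div_of_even (by omega)]
    simp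
  · rw [show ((2 * k + 1 : ℕ) - 2 : ℤ) / 2 = k - 1 by omega,
      show ((2 * k + 1 : ℕ) - 1 : ℤ) / 2 = k by omega,
      show ((2 * k + 1 : ℕ) - 3 : ℤ) / 2 = k - 1 by omega,
      show ((2 * k + 1 : ℕ) : ℤ) / 2 = k by omega,
      chebyshevS_eval_add_two_mul_cos_two_pi_div_of_odd (by omega)]
    simp

end Reflection

section GeometricRepresentation

open Module Real

variable {B W : Type*}

/-- The simple root indexed by `i`, a basis vector of the space carrying the geometric
representation. -/
noncomputable abbrev simpleRoot (i : B) : B →₀ ℝ :=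
  Finsupp.single i 1

/-- The symmetric bilinear form attached to a Coxeter matrix, normalized so that every simple root
`α` satisfies `⟨α, α⟩ = 2`. An entry `0` of the matrix, which stands for `∞`, gives the value
`-2`. -/
noncomputable def cartanForm (M : CoxeterMatrix B) : LinearMap.BilinForm ℝ (B →₀ ℝ) :=
  Finsupp.linearCombination ℝ fun i ↦
    Finsupp.linearCombination ℝ fun j ↦ -(2 * cos (π / M i j))

section CartanForm

variable (M : CoxeterMatrix B)

theorem cartanForm_simpleRoot (i j : B) :
    cartanForm M (simpleRoot i) (simpleRoot j) = -(2 * cos (π / M i j)) := by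
  simp [cartanForm]

@[simp]
theorem cartanForm_simpleRoot_self (i : B) :
    cartanForm M (simpleRoot i) (simpleRoot i) = 2 := by
  simp [cartanForm_simpleRoot]

theorem cartanForm_isSymm : (cartanForm M).IsSymm := by
  refine ⟨fun u v ↦ ?_⟩
  have hflip : cartanForm M = (cartanForm M).flip := by
    ext i j
    simp [cartanForm, M.symmetric i j]
  exact congrArg (fun b ↦ b u v) hflip

theorem isIntegral_cartanForm_simpleRoot (i j : B) :
    IsIntegral ℤ (cartanForm M (simpleRoot i) (simpleRoot j)) := by
  have h := (Real.isIntegral_two_mul_cos_rat_mul_pi (1 / (M i j : ℚ))).neg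
  rw [cartanForm_simpleRoot, div_eq_inv_mul, ← one_div]
  simpa using h

theorem simpleReflection_mul_simpleReflection_pow (i j : B) :
    (reflection (cartanForm_simpleRoot_self M i) *
      reflection (cartanForm_simpleRoot_self M j)) ^ M i j = 1 := by
  have hij := cartanForm_simpleRoot M i j
  have hji := cartanForm_simpleRoot M j i
  rw [M.symmetric] at hji
  obtain h0 | h1 | h2 | h3 : M i j = 0 ∨ M i j = 1 ∨ M i j = 2 ∨ 3 ≤ M i j := by omega
  · rw [h0, pow_zero]
  · obtain rfl : i = j := by
      by_contra hne
      exact M.off_diagonal i j hne h1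
    rw [h1, pow_one]
    ext1 v
    rw [LinearEquiv.mul_apply, involutive_reflection (cartanForm_simpleRoot_self M i) v,
      LinearEquiv.coe_one, id_eq]
  · rw [h2] at hij hji ⊢
    exact reflection_mul_reflection_sq_eq_one _ _ (by simpa using hij) (by simpa using hji)
  · refine reflection_mul_reflection_pow_eq_one _ _ h3 ?_
    rw [hij, hji]
    ring

end CartanForm

variable [Group W] {M : CoxeterMatrix B} (cs : CoxeterSystem M W)

/-- The geometric representation of a Coxeter group, in which the simple reflection indexed by `i`
acts as the reflection in the simple root indexed by `i`. -/
noncomputable def geometricRep : Representation ℝ W (B →₀ ℝ) :=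
  (LinearEquiv.automorphismGroup.toLinearMapMonoidHom).comp
    (cs.lift ⟨fun i ↦ reflection (cartanForm_simpleRoot_self M i),
      simpleReflection_mul_simpleReflection_pow M⟩)

theorem geometricRep_simple (i : B) (v : B →₀ ℝ) :
    geometricRep cs (cs.simple i) v = v - cartanForm M (simpleRoot i) v • simpleRoot i := by
  simp only [geometricRep, MonoidHom.comp_apply]
  rw [cs.lift_apply_simple (simpleReflection_mul_simpleReflection_pow M)]
  rfl

theorem geometricRep_mul (w w' : W) (v : B →₀ ℝ) :
    geometricRep cs (w * w') v = geometricRep cs w (geometricRep cs w' v) := by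
  rw [map_mul, Module.End.mul_apply]

@[simp]
theorem geometricRep_simple_simpleRoot_self (i : B) :
    geometricRep cs (cs.simple i) (simpleRoot i) = -simpleRoot i := by
  rw [geometricRep_simple, cartanForm_simpleRoot_self]
  module

theorem geometricRep_simple_simpleRoot (i j : B) :
    geometricRep cs (cs.simple i) (simpleRoot j) =
      simpleRoot j + (2 * cos (π / M i j)) • simpleRoot i := by
  rw [geometricRep_simple, cartanForm_simpleRoot, neg_smul, sub_neg_eq_add]

theorem geometricRep_simple_apply_of_ne {i j : B} (h : j ≠ i) (v : B →₀ ℝ) :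
    geometricRep cs (cs.simple i) v j = v j := by
  simp [geometricRep_simple, h.symm]

theorem cartanForm_geometricRep (w : W) (u v : B →₀ ℝ) :
    cartanForm M (geometricRep cs w u) (geometricRep cs w v) = cartanForm M u v := by
  induction w using cs.simple_induction_left generalizing u v with
  | one => simp
  | mul_simple_left w i ih =>
    rw [geometricRep_mul, geometricRep_mul, ← ih u v]
    have hsymm := (cartanForm_isSymm M).eq (geometricRep cs w u) (simpleRoot i)
    simp only [geometricRep_simple, map_sub, map_smul, LinearMap.sub_apply, LinearMap.smul_apply,
      smul_eq_mul, cartanForm_simpleRoot_self, hsymm]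
    ring

end GeometricRepresentation

section Positivity

open CoxeterSystem Polynomial.Chebyshev Real

variable {B W : Type*} [Group W] {M : CoxeterMatrix B} (cs : CoxeterSystem M W)

theorem geometricRep_wordProd_alternatingWord (i j : B) (p : ℕ) :
    geometricRep cs (cs.wordProd (alternatingWord i j p)) (simpleRoot i) =
      (S ℝ p).eval (2 * cos (π / M i j)) • simpleRoot (if Even p then i else j) +
        (S ℝ (p - 1)).eval (2 * cos (π / M i j)) • simpleRoot (if Even p then j else i) := by
  induction p with
  | zero => simp [alternatingWord]
  | succ p ih =>
    have hS := congrArg (Polynomial.eval (2 * cos (π / M i j))) (S_add_two ℝ (p - 1))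
    rw [show (p : ℤ) - 1 + 2 = p + 1 by ring, sub_add_cancel] at hS
    simp only [Polynomial.eval_sub, Polynomial.eval_mul, Polynomial.eval_X] at hS
    rw [alternatingWord_succ', cs.wordProd_cons, geometricRep_mul, ih, map_add, map_smul,
      map_smul, Nat.cast_succ, add_sub_cancel_right, hS]
    by_cases hp : Even p
    · simp only [hp, if_true, Nat.even_add_one, not_true, if_false,
        geometricRep_simple_simpleRoot_self, geometricRep_simple_simpleRoot, M.symmetric j i]
      module
    · simp only [hp, if_true, Nat.even_add_one, not_false_eq_true, if_false,
        geometricRep_simple_simpleRoot_self, geometricRep_simple_simpleRoot]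
      module

theorem exists_eq_mul_wordProd_alternatingWord {w : W} {i : B} (hi : ¬ cs.IsRightDescent w i)
    (j : B) : ∃ (v : W) (p : ℕ), w = v * cs.wordProd (alternatingWord i j p) ∧
      cs.length w = cs.length v + p ∧ ¬ cs.IsRightDescent v i ∧ ¬ cs.IsRightDescent v j := by
  induction hn : cs.length w generalizing w i j with
  | zero =>
    obtain rfl := cs.length_eq_zero_iff.mp hn
    exact ⟨1, 0, by simp [alternatingWord], by simp, hi, cs.not_isRightDescent_one j⟩
  | succ n ih =>
    by_cases hj : cs.IsRightDescent w j
    · have hlen := cs.isRightDescent_iff.mp hj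
      obtain ⟨v, p, hv, hl, hvj, hvi⟩ :=
        ih (cs.isRightDescent_iff_not_isRightDescent_mul.mp hj) i (by omega)
      refine ⟨v, p + 1, ?_, by omega, hvi, hvj⟩
      rw [alternatingWord_succ, wordProd_concat, ← mul_assoc, ← hv,
        simple_mul_simple_cancel_right]
    · exact ⟨w, 0, by simp [alternatingWord], by omega, hi, hj⟩

theorem succ_le_of_length_mul_wordProd_alternatingWord {v : W} {i j : B} {p : ℕ}
    (hlen : cs.length (v * cs.wordProd (alternatingWord i j p)) = cs.length v + p)
    (hi : ¬ cs.IsRightDescent (v * cs.wordProd (alternatingWord i j p)) i) (hM : M i j ≠ 0) :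
    p + 1 ≤ M i j := by
  by_contra! hlt
  refine cs.not_isReduced_alternatingWord j i (m := p + 1) (by rwa [M.symmetric])
    (by rwa [M.symmetric]) ?_
  have hsucc := cs.not_isRightDescent_iff.mp hi
  rw [mul_assoc, ← wordProd_concat, ← alternatingWord_succ, hlen] at hsucc
  have hmul := cs.length_mul_le v (cs.wordProd (alternatingWord j i (p + 1)))
  have hword := cs.length_wordProd_le (alternatingWord j i (p + 1))
  rw [length_alternatingWord] at hword
  rw [CoxeterSystem.IsReduced, length_alternatingWord]
  omega

/-- Split off from `w` a maximal suffix alternating between `i` and a right descent `j`. The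
remaining factor is shorter, and the suffix maps `α_i` into the cone spanned by `α_i` and `α_j`. -/
theorem geometricRep_simpleRoot_nonneg {w : W} {i : B} (hi : ¬ cs.IsRightDescent w i) :
    0 ≤ geometricRep cs w (simpleRoot i) := by
  induction hn : cs.length w using Nat.strong_induction_on generalizing w i with
  | _ n ih =>
    rcases eq_or_ne w 1 with rfl | hw
    · simp
    obtain ⟨j, hj⟩ := cs.exists_rightDescent_of_ne_one hw
    have hij : M i j ≠ 1 := fun h ↦ M.off_diagonal i j (by rintro rfl; exact hi hj) h
    obtain ⟨v, p, rfl, hlen, hvi, hvj⟩ := exists_eq_mul_wordProd_alternatingWord cs hi j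
    have hp : p ≠ 0 := by
      rintro rfl
      rw [alternatingWord, wordProd_nil, mul_one] at hj
      exact hvj hj
    have hpm := succ_le_of_length_mul_wordProd_alternatingWord cs hlen hi
    have hcone (k : B) (hk : ¬ cs.IsRightDescent v k) :
        0 ≤ geometricRep cs v (simpleRoot k) := ih _ (by omega) hk rfl
    have hcoeff := chebyshevS_eval_two_mul_cos_pi_div_nonneg hij fun h ↦ p.le_succ.trans (hpm h)
    have hcoeff_succ := chebyshevS_eval_two_mul_cos_pi_div_nonneg hij hpm
    rw [Nat.cast_succ, add_sub_cancel_right] at hcoeff_succ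
    rw [geometricRep_mul, geometricRep_wordProd_alternatingWord, map_add, map_smul, map_smul]
    refine add_nonneg (smul_nonneg hcoeff_succ (hcone _ ?_)) (smul_nonneg hcoeff (hcone _ ?_)) <;>
      split_ifs <;> assumption

theorem geometricRep_simpleRoot_nonpos {w : W} {i : B} (hi : cs.IsRightDescent w i) :
    geometricRep cs w (simpleRoot i) ≤ 0 := by
  have h := geometricRep_simpleRoot_nonneg cs
    (cs.isRightDescent_iff_not_isRightDescent_mul.mp hi)
  rwa [geometricRep_mul, geometricRep_simple_simpleRoot_self, map_neg, neg_nonneg] at h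

end Positivity

section Roots

variable {B W : Type*} [Group W] {M : CoxeterMatrix B} {cs : CoxeterSystem M W} {β : B →₀ ℝ}

variable (cs) in
/-- The roots of a Coxeter system are the images of the simple roots under the geometric
representation. -/
def IsCoxeterRoot (β : B →₀ ℝ) : Prop :=
  ∃ (w : W) (i : B), geometricRep cs w (simpleRoot i) = β

theorem isCoxeterRoot_simpleRoot (i : B) : IsCoxeterRoot cs (simpleRoot i) :=
  ⟨1, i, by rw [map_one, Module.End.one_apply]⟩

namespace IsCoxeterRoot

theorem map (hβ : IsCoxeterRoot cs β) (w : W) :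
    IsCoxeterRoot cs (geometricRep cs w β) := by
  obtain ⟨w', i, rfl⟩ := hβ
  exact ⟨w * w', i, geometricRep_mul cs _ _ _⟩

theorem neg (hβ : IsCoxeterRoot cs β) : IsCoxeterRoot cs (-β) := by
  obtain ⟨w, i, rfl⟩ := hβ
  exact ⟨w * cs.simple i, i, by
    rw [geometricRep_mul, geometricRep_simple_simpleRoot_self, map_neg]⟩

theorem nonneg_or_nonpos (hβ : IsCoxeterRoot cs β) : 0 ≤ β ∨ β ≤ 0 := by
  obtain ⟨w, i, rfl⟩ := hβ
  by_cases hi : cs.IsRightDescent w i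
  · exact Or.inr (geometricRep_simpleRoot_nonpos cs hi)
  · exact Or.inl (geometricRep_simpleRoot_nonneg cs hi)

theorem cartanForm_self (hβ : IsCoxeterRoot cs β) : cartanForm M β β = 2 := by
  obtain ⟨w, i, rfl⟩ := hβ
  rw [cartanForm_geometricRep, cartanForm_simpleRoot_self]

theorem ne_zero (hβ : IsCoxeterRoot cs β) : β ≠ 0 := by
  rintro rfl
  simpa using hβ.cartanForm_self

theorem eq_simpleRoot (hβ : IsCoxeterRoot cs β) (hpos : 0 ≤ β) {i : B}
    (hi : geometricRep cs (cs.simple i) β ≤ 0) : β = simpleRoot i := by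
  have hsupport : β = β i • simpleRoot i := by
    ext j
    rcases eq_or_ne j i with rfl | hj
    · simp
    · have hle := hi j
      rw [geometricRep_simple_apply_of_ne cs hj] at hle
      simpa [hj.symm] using le_antisymm hle (hpos j)
  have hself := hβ.cartanForm_self
  rw [hsupport, map_smul, map_smul, LinearMap.smul_apply, cartanForm_simpleRoot_self, smul_eq_mul,
    smul_eq_mul] at hself
  have hone : β i = 1 := (pow_eq_one_iff_of_nonneg (hpos i) two_ne_zero).mp (by linarith)
  rw [hsupport, hone, one_smul]

end IsCoxeterRoot

end Roots

section AlmostPositive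

open Module

variable {B W : Type*} [Group W] {M : CoxeterMatrix B} {cs : CoxeterSystem M W}
  {φ : Dual ℝ (B →₀ ℝ)}

variable (cs) in
/-- A linear functional is almost positive if it is positive on all but finitely many positive
roots. When the rank is finite, these functionals form the interior of the Tits cone. -/
def IsAlmostPositive (φ : Dual ℝ (B →₀ ℝ)) : Prop :=
  {β | IsCoxeterRoot cs β ∧ 0 ≤ β ∧ φ β ≤ 0}.Finite

theorem IsCoxeterRoot.geometricRep_simple_nonneg {β : B →₀ ℝ} (hβ : IsCoxeterRoot cs β)
    (hpos : 0 ≤ β) {i : B} (hne : β ≠ simpleRoot i) :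
    0 ≤ geometricRep cs (cs.simple i) β :=
  (hβ.map _).nonneg_or_nonpos.resolve_right fun h ↦ hne (hβ.eq_simpleRoot hpos h)

variable (cs φ) in
/-- The positive roots on which a linear functional is negative. -/
def negativeRoots : Set (B →₀ ℝ) :=
  {β | IsCoxeterRoot cs β ∧ 0 ≤ β ∧ φ β < 0}

theorem mapsTo_geometricRep_simple_negativeRoots {i : B} (hi : φ (simpleRoot i) < 0) :
    Set.MapsTo (geometricRep cs (cs.simple i))
      (negativeRoots cs (φ ∘ₗ geometricRep cs (cs.simple i)))
      (negativeRoots cs φ \ {simpleRoot i}) := by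
  rintro β ⟨hβ, hpos, hlt⟩
  have hne : β ≠ simpleRoot i := by
    rintro rfl
    rw [LinearMap.comp_apply, geometricRep_simple_simpleRoot_self, map_neg] at hlt
    linarith
  refine ⟨⟨hβ.map _, hβ.geometricRep_simple_nonneg hpos hne, hlt⟩, fun heq ↦ ?_⟩
  have hneg : β = -simpleRoot i := ((geometricRep cs).apply_bijective (cs.simple i)).injective (by
    rw [heq, map_neg, geometricRep_simple_simpleRoot_self, neg_neg])
  have hcoord : (0 : ℝ) ≤ β i := hpos i
  norm_num [hneg] at hcoord

variable (cs) in
theorem isAlmostPositive_sum_coords :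
    IsAlmostPositive cs (Finsupp.linearCombination ℝ fun _ ↦ (1 : ℝ)) := by
  refine Set.finite_empty.subset fun β ⟨hβ, hpos, hle⟩ ↦ hβ.ne_zero ?_
  have hcoord : ∀ i ∈ β.support, 0 ≤ β i • (1 : ℝ) := fun i _ ↦ smul_nonneg (hpos i) zero_le_one
  have hzero := (Finset.sum_eq_zero_iff_of_nonneg hcoord).mp (le_antisymm hle
    (Finset.sum_nonneg hcoord))
  ext i
  by_contra hi
  exact hi (by simpa using hzero i (Finsupp.mem_support_iff.mpr hi))

namespace IsAlmostPositive

theorem comp_geometricRep (hφ : IsAlmostPositive cs φ) (w : W) :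
    IsAlmostPositive cs (φ ∘ₗ geometricRep cs w) := by
  induction w using cs.simple_induction_right with
  | one => simpa [Module.End.one_eq_id] using hφ
  | mul_simple_right w i ih =>
    have hinj := ((geometricRep cs).apply_bijective (cs.simple i)).injective
    refine ((ih.preimage hinj.injOn).insert (simpleRoot i)).subset fun β ⟨hβ, hpos, hle⟩ ↦ ?_
    refine or_iff_not_imp_left.mpr fun hne ↦
      ⟨hβ.map _, hβ.geometricRep_simple_nonneg hpos hne, ?_⟩
    simpa only [LinearMap.comp_apply, geometricRep_mul] using hle

theorem sum {ι : Type*} {s : Finset ι} (hs : s.Nonempty) {φ : ι → Dual ℝ (B →₀ ℝ)}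
    (hφ : ∀ k ∈ s, IsAlmostPositive cs (φ k)) : IsAlmostPositive cs (∑ k ∈ s, φ k) := by
  refine (s.finite_toSet.biUnion hφ).subset fun β ⟨hβ, hpos, hle⟩ ↦ ?_
  rw [LinearMap.sum_apply] at hle
  obtain ⟨k, hk, hneg⟩ := Finset.exists_le_of_sum_le hs (hle.trans_eq Finset.sum_const_zero.symm)
  exact Set.mem_biUnion hk ⟨hβ, hpos, hneg⟩

theorem finite_setOf_apply_eq_zero (hφ : IsAlmostPositive cs φ) :
    {β | IsCoxeterRoot cs β ∧ φ β = 0}.Finite := by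
  refine (hφ.union hφ.neg).subset fun β ⟨hβ, hzero⟩ ↦ ?_
  rcases hβ.nonneg_or_nonpos with hpos | hneg
  · exact Or.inl ⟨hβ, hpos, hzero.le⟩
  · exact Or.inr ⟨hβ.neg, neg_nonneg.mpr hneg, by rw [map_neg, hzero, neg_zero]⟩

theorem finite_negativeRoots (hφ : IsAlmostPositive cs φ) : (negativeRoots cs φ).Finite :=
  hφ.subset fun _ ⟨hβ, hpos, hlt⟩ ↦ ⟨hβ, hpos, hlt.le⟩

/-- Applying a simple reflection in whose root `φ` is negative decreases the number of positive
roots on which `φ` is negative. -/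
theorem exists_comp_geometricRep_nonneg (hφ : IsAlmostPositive cs φ) :
    ∃ w, ∀ i, 0 ≤ (φ ∘ₗ geometricRep cs w) (simpleRoot i) := by
  induction hn : (negativeRoots cs φ).ncard using Nat.strong_induction_on generalizing φ with
  | _ n ih =>
    by_cases hnonneg : ∀ i, 0 ≤ φ (simpleRoot i)
    · exact ⟨1, by simpa using hnonneg⟩
    obtain ⟨i, hi⟩ := not_forall.mp hnonneg
    rw [not_le] at hi
    have hmem : simpleRoot i ∈ negativeRoots cs φ :=
      ⟨isCoxeterRoot_simpleRoot i, Finsupp.single_nonneg.mpr zero_le_one, hi⟩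
    have hinj := ((geometricRep cs).apply_bijective (cs.simple i)).injective
    have hlt : (negativeRoots cs (φ ∘ₗ geometricRep cs (cs.simple i))).ncard < n :=
      (Set.ncard_le_ncard_of_injOn _ (mapsTo_geometricRep_simple_negativeRoots hi) hinj.injOn
        hφ.finite_negativeRoots.sdiff).trans_lt
        (hn ▸ Set.ncard_sdiff_singleton_lt_of_mem hmem hφ.finite_negativeRoots)
    obtain ⟨w, hw⟩ := ih _ hlt (hφ.comp_geometricRep (cs.simple i)) rfl
    exact ⟨cs.simple i * w, by simpa only [LinearMap.comp_apply, geometricRep_mul] using hw⟩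

end IsAlmostPositive

variable (cs) in
theorem exists_isAlmostPositive_comp_geometricRep_eq {x : W} (hx : IsOfFinOrder x) :
    ∃ φ, IsAlmostPositive cs φ ∧ φ ∘ₗ geometricRep cs x = φ := by
  let φ₀ : Dual ℝ (B →₀ ℝ) := Finsupp.linearCombination ℝ fun _ ↦ 1
  refine ⟨∑ k ∈ Finset.range (orderOf x), φ₀ ∘ₗ geometricRep cs (x ^ k),
    .sum (Finset.nonempty_range_iff.mpr hx.orderOf_pos.ne') fun k _ ↦
      (isAlmostPositive_sum_coords cs).comp_geometricRep _, ?_⟩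
  have hshift := (Finset.sum_range_succ' (fun k ↦ φ₀ ∘ₗ geometricRep cs (x ^ k))
    (orderOf x)).symm.trans (Finset.sum_range_succ _ (orderOf x))
  rw [pow_zero, pow_orderOf_eq_one] at hshift
  refine Eq.trans (LinearMap.ext fun v ↦ ?_) (add_right_cancel hshift)
  simp only [LinearMap.comp_apply, LinearMap.sum_apply, ← geometricRep_mul, ← pow_succ]

end AlmostPositive

section StandardParabolic

open Module

variable {B W : Type*} [Group W] {M : CoxeterMatrix B} (cs : CoxeterSystem M W)

/-- The standard parabolic subgroup generated by the simple reflections indexed by `I`. -/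
def standardParabolic (I : Set B) : Subgroup W :=
  Subgroup.closure (cs.simple '' I)

theorem simple_mem_standardParabolic {I : Set B} {i : B} (hi : i ∈ I) :
    cs.simple i ∈ standardParabolic cs I :=
  Subgroup.subset_closure (Set.mem_image_of_mem _ hi)

variable {cs} {I : Set B} {φ : Dual ℝ (B →₀ ℝ)}

@[elab_as_elim]
theorem standardParabolic_induction {p : ∀ w ∈ standardParabolic cs I, Prop}
    (one : p 1 (one_mem _))
    (simple_mul : ∀ i (hi : i ∈ I) w (hw : w ∈ standardParabolic cs I), p w hw →
      p (cs.simple i * w) (mul_mem (simple_mem_standardParabolic cs hi) hw))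
    {w : W} (hw : w ∈ standardParabolic cs I) : p w hw := by
  induction hw using Subgroup.closure_induction_left with
  | one => exact one
  | mul_left s hs w hw ih =>
    obtain ⟨i, hi, rfl⟩ := hs
    exact simple_mul i hi w hw ih
  | inv_mul_cancel s hs w hw ih =>
    obtain ⟨i, hi, rfl⟩ := hs
    simpa only [cs.inv_simple] using simple_mul i hi w hw ih

theorem geometricRep_apply_of_mem_standardParabolic {w : W} (hw : w ∈ standardParabolic cs I)
    {j : B} (hj : j ∉ I) (v : B →₀ ℝ) : geometricRep cs w v j = v j := by
  induction hw using standardParabolic_induction with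
  | one => rw [map_one, End.one_apply]
  | simple_mul i hi w _ ih =>
    rw [geometricRep_mul, geometricRep_simple_apply_of_ne cs (by rintro rfl; exact hj hi), ih]

theorem apply_geometricRep_of_mem_standardParabolic (hφ : ∀ i ∈ I, φ (simpleRoot i) = 0) {w : W}
    (hw : w ∈ standardParabolic cs I) (v : B →₀ ℝ) : φ (geometricRep cs w v) = φ v := by
  induction hw using standardParabolic_induction with
  | one => rw [map_one, End.one_apply]
  | simple_mul i hi w _ ih =>
    rw [geometricRep_mul, geometricRep_simple, map_sub, map_smul, hφ i hi, smul_zero, sub_zero, ih]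

theorem eq_one_of_mem_standardParabolic {w : W} (hw : w ∈ standardParabolic cs I)
    (hfix : ∀ i ∈ I, geometricRep cs w (simpleRoot i) = simpleRoot i) : w = 1 := by
  by_contra hne
  obtain ⟨i, hi⟩ := cs.exists_rightDescent_of_ne_one hne
  have hcoord : geometricRep cs w (simpleRoot i) i = simpleRoot i i := by
    by_cases hI : i ∈ I
    · rw [hfix i hI]
    · exact geometricRep_apply_of_mem_standardParabolic hw hI _
  have hle := geometricRep_simpleRoot_nonpos cs hi i
  norm_num [hcoord] at hle

theorem finite_standardParabolic (hφ : IsAlmostPositive cs φ)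
    (hI : ∀ i ∈ I, φ (simpleRoot i) = 0) : Finite (standardParabolic cs I) := by
  let F := {β | IsCoxeterRoot cs β ∧ φ β = 0}
  have : Finite F := hφ.finite_setOf_apply_eq_zero
  have : Finite I := by
    refine Finite.of_injective
      (fun i : I ↦ (⟨simpleRoot i, isCoxeterRoot_simpleRoot _, hI i i.2⟩ : F)) fun i j hij ↦ ?_
    exact Subtype.ext (Finsupp.single_left_injective one_ne_zero (congrArg Subtype.val hij))
  have hmem (w : standardParabolic cs I) (i : I) :
      geometricRep cs w (simpleRoot i) ∈ F :=
    ⟨(isCoxeterRoot_simpleRoot _).map _,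
      (apply_geometricRep_of_mem_standardParabolic hI w.2 _).trans (hI i i.2)⟩
  refine Finite.of_injective (fun w i ↦ (⟨_, hmem w i⟩ : F)) fun w w' hww' ↦ ?_
  refine Subtype.ext (inv_mul_eq_one.mp
    (eq_one_of_mem_standardParabolic (mul_mem (inv_mem w.2) w'.2) fun i hi ↦ ?_))
  have heq := congrArg Subtype.val (congrFun hww' ⟨i, hi⟩)
  dsimp only at heq
  rw [geometricRep_mul, ← heq, Representation.inv_self_apply]

theorem apply_nonneg_of_forall_simpleRoot (hφ : ∀ i, 0 ≤ φ (simpleRoot i)) {v : B →₀ ℝ}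
    (hv : 0 ≤ v) : 0 ≤ φ v := by
  rw [← v.sum_single, map_finsuppSum]
  refine Finset.sum_nonneg fun i _ ↦ ?_
  dsimp only
  rw [← Finsupp.smul_single_one, map_smul]
  exact smul_nonneg (hv i) (hφ i)

theorem mem_standardParabolic_of_comp_geometricRep_eq (hφ : ∀ i, 0 ≤ φ (simpleRoot i)) {w : W}
    (hw : φ ∘ₗ geometricRep cs w = φ) :
    w ∈ standardParabolic cs {i | φ (simpleRoot i) = 0} := by
  induction hn : cs.length w using Nat.strong_induction_on generalizing w with
  | _ n ih =>
    rcases eq_or_ne w 1 with rfl | hne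
    · exact one_mem _
    obtain ⟨i, hi⟩ := cs.exists_rightDescent_of_ne_one hne
    have hzero : φ (simpleRoot i) = 0 := by
      have hneg := apply_nonneg_of_forall_simpleRoot hφ
        (neg_nonneg.mpr (geometricRep_simpleRoot_nonpos cs hi))
      rw [map_neg, ← LinearMap.comp_apply, hw] at hneg
      linarith [hφ i]
    have hsimple : i ∈ {i | φ (simpleRoot i) = 0} := hzero
    have hmem : w * cs.simple i ∈ standardParabolic cs {i | φ (simpleRoot i) = 0} := by
      refine ih _ (hn ▸ hi) (LinearMap.ext fun v ↦ ?_) rfl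
      rw [LinearMap.comp_apply, geometricRep_mul, ← LinearMap.comp_apply, hw]
      exact apply_geometricRep_of_mem_standardParabolic (fun _ h ↦ h)
        (simple_mem_standardParabolic cs hsimple) v
    rw [← cs.simple_mul_simple_cancel_right (w := w) i]
    exact mul_mem hmem (simple_mem_standardParabolic cs hsimple)

variable (cs) in
theorem exists_isConj_mem_finite_standardParabolic {x : W} (hx : IsOfFinOrder x) :
    ∃ (I : Set B) (y : W), Finite (standardParabolic cs I) ∧ y ∈ standardParabolic cs I ∧
      IsConj x y := by
  obtain ⟨φ, hφ, hinv⟩ := exists_isAlmostPositive_comp_geometricRep_eq cs hx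
  obtain ⟨g, hg⟩ := hφ.exists_comp_geometricRep_nonneg
  refine ⟨_, g⁻¹ * x * g, finite_standardParabolic (hφ.comp_geometricRep g) fun i hi ↦ hi,
    mem_standardParabolic_of_comp_geometricRep_eq hg (LinearMap.ext fun v ↦ ?_),
    isConj_iff.mpr ⟨g⁻¹, by group⟩⟩
  rw [LinearMap.comp_apply, LinearMap.comp_apply, ← geometricRep_mul,
    show g * (g⁻¹ * x * g) = x * g by group, geometricRep_mul, ← LinearMap.comp_apply, hinv,
    LinearMap.comp_apply]

end StandardParabolic

section ResidualFiniteness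

variable {B W : Type*} [Group W] {M : CoxeterMatrix B} (cs : CoxeterSystem M W)

/-- The subring of `ℝ` generated by the entries of the Cartan form indexed by `K`. -/
def cartanRing (M : CoxeterMatrix B) (K : Set B) : Subalgebra ℤ ℝ :=
  Algebra.adjoin ℤ (Set.image2 (fun i j ↦ cartanForm M (simpleRoot i) (simpleRoot j)) K K)

/-- The lattice spanned over `cartanRing M K` by the simple roots indexed by `K`. -/
noncomputable def rootLattice (M : CoxeterMatrix B) (K : Set B) : Submodule ℤ (B →₀ ℝ) :=
  (Submodule.span (cartanRing M K) (simpleRoot '' K)).restrictScalars ℤ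

theorem finite_cartanRing (M : CoxeterMatrix B) (K : Set B) [Finite K] :
    Module.Finite ℤ (cartanRing M K) := by
  refine Module.Finite.iff_fg (N := Subalgebra.toSubmodule (cartanRing M K)).mpr
    (fg_adjoin_of_finite (K.toFinite.image2 _ K.toFinite) ?_)
  rintro _ ⟨i, _, j, _, rfl⟩
  exact isIntegral_cartanForm_simpleRoot M i j

theorem finite_rootLattice (M : CoxeterMatrix B) (K : Set B) [Finite K] :
    Module.Finite ℤ (rootLattice M K) := by
  have := finite_cartanRing M K
  exact Module.Finite.iff_fg.mpr (Submodule.fg_span (K.toFinite.image simpleRoot)).restrictScalars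

variable {cs} {K : Set B}

theorem geometricRep_mem_rootLattice {w : W} (hw : w ∈ standardParabolic cs K) {v : B →₀ ℝ}
    (hv : v ∈ rootLattice M K) : geometricRep cs w v ∈ rootLattice M K := by
  induction hw using standardParabolic_induction with
  | one => rwa [map_one, Module.End.one_apply]
  | simple_mul i hi w _ ih =>
    rw [geometricRep_mul]
    generalize geometricRep cs w v = u at ih
    induction ih using Submodule.span_induction with
    | mem u hu =>
      obtain ⟨j, hj, rfl⟩ := hu
      let c : cartanRing M K :=
        ⟨cartanForm M (simpleRoot i) (simpleRoot j), Algebra.subset_adjoin ⟨i, hi, j, hj, rfl⟩⟩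
      rw [geometricRep_simple]
      exact sub_mem (Submodule.subset_span ⟨j, hj, rfl⟩)
        (Submodule.smul_mem _ c (Submodule.subset_span ⟨i, hi, rfl⟩))
    | zero => rw [map_zero]; exact zero_mem _
    | add u u' _ _ hu hu' => rw [map_add]; exact add_mem hu hu'
    | smul c u _ hu =>
      have hsmul : geometricRep cs (cs.simple i) (c • u) =
        c • geometricRep cs (cs.simple i) u := map_smul _ (c : ℝ) u
      rw [hsmul]
      exact Submodule.smul_mem _ c hu

variable (cs K) in
/-- The action of a standard parabolic subgroup on its root lattice. -/
noncomputable def rootLatticeRep : Representation ℤ (standardParabolic cs K) (rootLattice M K) where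
  toFun w := ((geometricRep cs w).restrictScalars ℤ).restrict
    fun _ hv ↦ geometricRep_mem_rootLattice w.2 hv
  map_one' := by
    ext1 v
    exact Subtype.ext (LinearMap.congr_fun (map_one (geometricRep cs)) v)
  map_mul' w w' := by
    ext1 v
    exact Subtype.ext (geometricRep_mul cs w w' v)

theorem rootLatticeRep_injective : Function.Injective (rootLatticeRep cs K) := by
  refine (injective_iff_map_eq_one _).mpr fun w hw ↦ Subtype.ext
    (eq_one_of_mem_standardParabolic w.2 fun i hi ↦ ?_)
  exact congrArg Subtype.val
    (LinearMap.congr_fun hw ⟨simpleRoot i, Submodule.subset_span ⟨i, hi, rfl⟩⟩)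

theorem residuallyFinite_standardParabolic [Finite K] :
    Group.ResiduallyFinite (standardParabolic cs K) :=
  have := finite_rootLattice M K
  residuallyFinite_of_injective_representation (rootLatticeRep cs K) rootLatticeRep_injective

end ResidualFiniteness

section EvenRetraction

variable {B W : Type*} [Group W] {M : CoxeterMatrix B} (cs : CoxeterSystem M W)

theorem isLiftable_ite_simple_one (hM : M.IsEven) (I : Set B) [DecidablePred (· ∈ I)] :
    M.IsLiftable fun i ↦
      if hi : i ∈ I then (⟨cs.simple i, simple_mem_standardParabolic cs hi⟩ :
        standardParabolic cs I) else 1 := by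
  intro i j
  have hpow {k : B} (hij : i ≠ j) : cs.simple k ^ M i j = 1 := by
    obtain ⟨n, hn⟩ := hM i j hij
    rw [hn, ← two_mul, pow_mul, cs.simple_sq, one_pow]
  apply Subtype.ext
  by_cases hi : i ∈ I <;> by_cases hj : j ∈ I <;>
    simp only [hi, hj, dite_true, dite_false, mul_one, one_mul, one_pow, SubmonoidClass.mk_pow,
      MulMemClass.mk_mul_mk, OneMemClass.coe_one]
  · exact cs.simple_mul_simple_pow i j
  · exact hpow fun h ↦ hj (h ▸ hi)
  · exact hpow fun h ↦ hi (h ▸ hj)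

variable (hM : M.IsEven) {I J : Set B} {x y : W}

open Classical in
/-- The retraction of an even Coxeter group onto a standard parabolic subgroup that sends the
simple reflections outside the subgroup to `1`. -/
noncomputable def parabolicRetraction (I : Set B) : W →* standardParabolic cs I :=
  cs.lift ⟨_, isLiftable_ite_simple_one cs hM I⟩

open Classical in
theorem coe_parabolicRetraction_simple (I : Set B) (i : B) :
    (parabolicRetraction cs hM I (cs.simple i) : W) = if i ∈ I then cs.simple i else 1 := by
  rw [parabolicRetraction, cs.lift_apply_simple (isLiftable_ite_simple_one cs hM I)]
  split_ifs <;> rfl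

theorem coe_parabolicRetraction_of_mem (hx : x ∈ standardParabolic cs I) :
    (parabolicRetraction cs hM I x : W) = x := by
  refine MonoidHom.eqOn_closure (g := MonoidHom.id W)
    (f := (standardParabolic cs I).subtype.comp (parabolicRetraction cs hM I)) ?_ hx
  rintro _ ⟨i, hi, rfl⟩
  simp [coe_parabolicRetraction_simple, hi]

theorem coe_parabolicRetraction_comm (I J : Set B) (x : W) :
    (parabolicRetraction cs hM I (parabolicRetraction cs hM J x) : W) =
      parabolicRetraction cs hM J (parabolicRetraction cs hM I x) := by
  induction x using cs.simple_induction_left with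
  | one => simp
  | mul_simple_left w i ih =>
    simp only [map_mul, Subgroup.coe_mul, ih]
    by_cases hi : i ∈ I <;> by_cases hj : i ∈ J <;>
      simp [coe_parabolicRetraction_simple, hi, hj]

theorem isConj_of_isConj_parabolicRetraction (hx : x ∈ standardParabolic cs I)
    (hy : y ∈ standardParabolic cs J)
    (hI : IsConj (parabolicRetraction cs hM I x) (parabolicRetraction cs hM I y))
    (hJ : IsConj (parabolicRetraction cs hM J x) (parabolicRetraction cs hM J y)) :
    IsConj x y := by
  have hI' := (standardParabolic cs I).subtype.map_isConj hI
  have hJ' := (standardParabolic cs J).subtype.map_isConj hJ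
  simp only [Subgroup.subtype_apply, coe_parabolicRetraction_of_mem cs hM hx,
    coe_parabolicRetraction_of_mem cs hM hy] at hI' hJ'
  have hIJ := ((standardParabolic cs J).subtype.comp (parabolicRetraction cs hM J)).map_isConj hI'
  rw [MonoidHom.comp_apply, MonoidHom.comp_apply, Subgroup.subtype_apply, Subgroup.subtype_apply,
    ← coe_parabolicRetraction_comm, coe_parabolicRetraction_of_mem cs hM hy] at hIJ
  exact hI'.trans (hIJ.symm.trans hJ')

include cs hM in
theorem conjugacySeparated_of_isOfFinOrder (hx : IsOfFinOrder x) (hy : IsOfFinOrder y)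
    (hxy : ¬ IsConj x y) : ConjugacySeparated x y := by
  obtain ⟨I, x', hIfin, hx', hxx'⟩ := exists_isConj_mem_finite_standardParabolic cs hx
  obtain ⟨J, y', hJfin, hy', hyy'⟩ := exists_isConj_mem_finite_standardParabolic cs hy
  have transport (K : Set B)
      (h : IsConj (parabolicRetraction cs hM K x) (parabolicRetraction cs hM K y)) :
      IsConj (parabolicRetraction cs hM K x') (parabolicRetraction cs hM K y') :=
    ((parabolicRetraction cs hM K).map_isConj hxx'.symm).trans
      (h.trans ((parabolicRetraction cs hM K).map_isConj hyy'))
  by_cases hI : IsConj (parabolicRetraction cs hM I x) (parabolicRetraction cs hM I y)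
  · refine .of_not_isConj_map (parabolicRetraction cs hM J) fun hJ ↦ hxy ?_
    exact hxx'.trans ((isConj_of_isConj_parabolicRetraction cs hM hx' hy' (transport I hI)
      (transport J hJ)).trans hyy'.symm)
  · exact .of_not_isConj_map (parabolicRetraction cs hM I) hI

theorem exists_finite_mem_standardParabolic (x : W) :
    ∃ K : Set B, K.Finite ∧ x ∈ standardParabolic cs K := by
  obtain ⟨ω, rfl⟩ := cs.wordProd_surjective x
  refine ⟨{i | i ∈ ω}, ω.finite_toSet, Subgroup.list_prod_mem _ fun s hs ↦ ?_⟩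
  obtain ⟨i, hi, rfl⟩ := List.mem_map.mp hs
  exact simple_mem_standardParabolic cs hi

include cs hM in
theorem residuallyFinite_of_isEven : Group.ResiduallyFinite W := by
  refine Group.residuallyFinite_of_forall_exists_finite_monoidHom fun x hx ↦ ?_
  obtain ⟨K, hK, hxK⟩ := exists_finite_mem_standardParabolic cs x
  have : Finite K := hK
  have := residuallyFinite_standardParabolic (cs := cs) (K := K)
  have hne : parabolicRetraction cs hM K x ≠ 1 := fun h ↦
    hx ((coe_parabolicRetraction_of_mem cs hM hxK).symm.trans (congrArg Subtype.val h))
  obtain ⟨N, hN⟩ := Group.exists_finiteIndexNormalSubgroup_notMem _ hne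
  exact ⟨_, inferInstance, inferInstance,
    (QuotientGroup.mk' N.toSubgroup).comp (parabolicRetraction cs hM K),
    fun h ↦ hN ((QuotientGroup.eq_one_iff _).mp h)⟩

end EvenRetraction

theorem mainTheorem10_general {B W : Type*} [Group W] {M : CoxeterMatrix B}
    (cs : CoxeterSystem M W) (hM : M.IsEven) (x : W) (hx : IsOfFinOrder x) :
    IsConjugacyDistinguished x := by
  have := residuallyFinite_of_isEven cs hM
  refine isConjugacyDistinguished_of_forall_conjugacySeparated fun y hxy ↦ ?_
  by_cases hy : IsOfFinOrder y
  · exact conjugacySeparated_of_isOfFinOrder cs hM hx hy hxy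
  · exact .of_isOfFinOrder_of_not hx hy

theorem mainTheorem10 {B W : Type*} [Finite B] [Group W] {M : CoxeterMatrix B}
    (cs : CoxeterSystem M W) (hM : M.IsEven) (x : W) (hx : IsOfFinOrder x) :
    IsConjugacyDistinguished x :=
  mainTheorem10_general cs hM x hx
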